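/- Let $d\in\mathbb N$, $1\le p,q<\infty$, and let functions take real or complex values. Let $L^{p,q}$ be the space of (classes of) measurable functions on $\mathbb R\times\mathbb R^d$ with $\|f\|_{L^{p,q}}=\big[\int_{\mathbb R}\big(\int_{\mathbb R^d}|f(x,y)|^q\,dy\big)^{p/q}dx\big]^{1/p}<\infty$, and $\ell^{p,q}$ the space of sequences $c$ on $\mathbb Z\times\mathbb Z^d$ with $\sum_{k_1}\big(\sum_{k_2}|c(k_1,k_2)|^q\big)^{p/q}<\infty$. Let $W_0(L^{1,1})$ be the space of continuous functions $\phi$ on $\mathbb R\times\mathbb R^d$ with $\sum_{n\in\mathbb Z}\sup_{x\in[0,1]}\sum_{l\in\mathbb Z^d}\sup_{y\in[0,1]^d}|\phi(x+n,y+l)|<\infty$, and put $$V_{p,q}(\phi)=\Big\{\sum_{k\in\mathbb Z^{d+1}}c(k)\,\phi(\cdot-k):\ c\in\ell^{p,q}\Big\}.$$ A family of points $X=\{(x_j,y_k):j,k\in\mathbb J\}$ of $\mathbb R\times\mathbb R^d$, with $\mathbb J$ countable, is called $\gamma$-dense if $\mathbb R^{d+1}=\bigcup_{j,k}B_{\gamma'}(x_j,y_k)$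 for every $\gamma'>\gamma$, where $B_{\gamma'}$ denotes the open Euclidean ball of radius $\gamma'$. A bounded uniform partition of unity of radius $r$ for $X$ is a family of measurable functions $\beta_{j,k}$ with $0\le\beta_{j,k}\le1$, $\beta_{j,k}=0$ outside $B_r(x_j,y_k)$, and $\sum_{j,k}\beta_{j,k}=1$. The corresponding quasi-interpolant is $Q_Xf=\sum_{j,k}f(x_j,y_k)\beta_{j,k}$. **Theorem.** Let $\phi\in W_0(L^{1,1})$ have compact support, and let $P$ be a bounded linear projection from $L^{p,q}$ onto $V_{p,q}(\phi)$. (All elements of $V_{p,q}(\phi)$ are continuous, and $Pg$ denotes the continuous representative.) Then there are a density $\gamma>0$, a radius $r>\gamma$ and a number $0\le\alpha<1$ such that for every $f\in V_{p,q}(\phi)$ there is a constant $M<\infty$ with the following property. Let $X$ be any $\gamma$-dense set and $Q_X$ the quasi-interpolant of any bounded uniform partition of unity of radius $r$ for $X$. Then $Q_X$ is well defined on $V_{p,q}(\phi)$ (its series converges absolutely at every point) and maps it into $L^{p,q}$, and the iterates $$f_1=PQ_Xf,\qquad f_{n+1}=PQ_X(f-f_n)+f_n\quad(n\ge1)$$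 lie in $V_{p,q}(\phi)$, converge to $f$ in $L^{p,q}$ and uniformly on $\mathbb R^{d+1}$, and satisfy $$\|f-f_n\|_{L^{p,q}}\le M\alpha^n\qquad(n\ge1).$$ -/

import Mathlib

open MeasureTheory Filter Topology
open scoped ENNReal NNReal

noncomputable section

namespace MixedSampling

/-- The space `ℝ × ℝ^d`, that is `ℝ^{d+1}`, with Lebesgue measure. -/
abbrev Plane (d : ℕ) : Type := ℝ × (Fin d → ℝ)

/-- The lattice `ℤ × ℤ^d`. -/
abbrev Lattice (d : ℕ) : Type := ℤ × (Fin d → ℤ)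

/-- A lattice point regarded as a point of `ℝ × ℝ^d`. -/
def Lattice.toPlane {d : ℕ} (k : Lattice d) : Plane d :=
  ((k.1 : ℝ), fun i => (k.2 i : ℝ))

/-- The open Euclidean ball of `ℝ^{d+1}` with centre `a` and radius `r` (the metric that Mathlib
puts on the product is the sup metric, so the Euclidean distance is written out). -/
def euclBall {d : ℕ} (a : Plane d) (r : ℝ) : Set (Plane d) :=
  {z | Real.sqrt ((z.1 - a.1) ^ 2 + ∑ i, (z.2 i - a.2 i) ^ 2) < r}

section Spaces

variable {𝕜 : Type*} [RCLike 𝕜] {d : ℕ}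

/-- The mixed Lebesgue norm
`‖f‖_{L^{p,q}} = (∫ (∫ |f(x,y)|^q dy)^{p/q} dx)^{1/p}`, with values in `[0,∞]`. -/
def mixedNorm (p q : ℝ) (f : Plane d → 𝕜) : ℝ≥0∞ :=
  (∫⁻ x : ℝ, (∫⁻ y : Fin d → ℝ, ‖f (x, y)‖ₑ ^ q) ^ (p / q)) ^ (1 / p)

/-- `f` is (a representative of) an element of `L^{p,q}`. -/
def MemMixedLp (p q : ℝ) (f : Plane d → 𝕜) : Prop :=
  AEStronglyMeasurable f volume ∧ mixedNorm p q f < ∞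

/-- The mixed sequence norm `‖c‖_{ℓ^{p,q}} = (∑_{k₁} (∑_{k₂} |c(k₁,k₂)|^q)^{p/q})^{1/p}`. -/
def seqNorm (p q : ℝ) (c : Lattice d → 𝕜) : ℝ≥0∞ :=
  (∑' k₁ : ℤ, (∑' k₂ : Fin d → ℤ, ‖c (k₁, k₂)‖ₑ ^ q) ^ (p / q)) ^ (1 / p)

/-- The norm of the mixed Wiener amalgam space `W(L^{p,q})`; the suprema are genuine suprema. -/
def wienerNorm (p q : ℝ) (f : Plane d → 𝕜) : ℝ≥0∞ :=
  (∑' n : ℤ, ⨆ x ∈ Set.Icc (0 : ℝ) 1,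
    (∑' l : Fin d → ℤ, ⨆ y ∈ Set.Icc (0 : Fin d → ℝ) 1,
      ‖f ((x, y) + Lattice.toPlane (n, l))‖ₑ ^ q) ^ (p / q)) ^ (1 / p)

/-- `f` belongs to `W₀(L^{p,q})`: it is continuous and lies in `W(L^{p,q})`. -/
def MemWiener₀ (p q : ℝ) (f : Plane d → 𝕜) : Prop :=
  Continuous f ∧ wienerNorm p q f < ∞

/-- The semi-discrete convolution `∑_k c(k) φ(· - k)`. For `φ ∈ W(L^{1,1})` and bounded `c` the
series converges absolutely at every point. -/
def semiConv (c : Lattice d → 𝕜) (φ : Plane d → 𝕜) : Plane d → 𝕜 :=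
  fun z => ∑' k : Lattice d, c k * φ (z - k.toPlane)

/-- The principal shift-invariant space `V_{p,q}(φ)`, as a set of genuine functions. For `φ`
continuous with compact support all its elements are continuous, so that they can be sampled, and
each class of functions modulo null sets contains at most one of them. -/
def shiftInvariant (p q : ℝ) (φ : Plane d → 𝕜) : Set (Plane d → 𝕜) :=
  {f | ∃ c : Lattice d → 𝕜, seqNorm p q c < ∞ ∧ f = semiConv c φ}

/-- `P` is a bounded linear projection from `L^{p,q}` onto `V_{p,q}(φ)`. The argument of `P` is any
representative of an element of `L^{p,q}`, and only its class modulo null sets matters; the value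
is the element of `V_{p,q}(φ)` itself, i.e. for continuous compactly supported `φ` the continuous
representative. What `P` does to functions outside `L^{p,q}` is irrelevant. -/
structure IsBoundedProjection (p q : ℝ) (φ : Plane d → 𝕜)
    (P : (Plane d → 𝕜) → (Plane d → 𝕜)) : Prop where
  congr_ae : ∀ f g, MemMixedLp p q f → MemMixedLp p q g → f =ᵐ[volume] g → P f = P g
  map_add : ∀ f g, MemMixedLp p q f → MemMixedLp p q g → P (f + g) = P f + P g
  map_smul : ∀ (a : 𝕜) (f), MemMixedLp p q f → P (a • f) = a • P f
  bounded : ∃ C : ℝ≥0, ∀ f, MemMixedLp p q f → mixedNorm p q (P f) ≤ C * mixedNorm p q f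
  mem : ∀ f, MemMixedLp p q f → P f ∈ shiftInvariant p q φ
  fixes : ∀ f ∈ shiftInvariant p q φ, P f = f

end Spaces

section Sampling

variable {d : ℕ} {J : Type*}

/-- The sampling set `{(x j, y k) : j, k ∈ J}` is `γ₀`-dense: for every `γ > γ₀` the open balls of
radius `γ` around its points cover `ℝ^{d+1}`. -/
def IsDenseSampling (γ₀ : ℝ) (x : J → ℝ) (y : J → Fin d → ℝ) : Prop :=
  ∀ γ > γ₀, (⋃ j, ⋃ k, euclBall (x j, y k) γ) = Set.univ

/-- `β` is a bounded uniform partition of unity for the sampling set `{(x j, y k)}`, with supports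
in the open balls of radius `r`. (Only the set where `β j k` does not vanish is required to lie in
the ball, which is implied by the same requirement on its closure.) -/
structure IsBUPU (r : ℝ) (x : J → ℝ) (y : J → Fin d → ℝ) (β : J → J → Plane d → ℝ) : Prop where
  aemeasurable : ∀ j k, AEMeasurable (β j k) volume
  nonneg : ∀ j k z, 0 ≤ β j k z
  le_one : ∀ j k z, β j k z ≤ 1
  support_subset : ∀ j k, Function.support (β j k) ⊆ euclBall (x j, y k) r
  hasSum_one : ∀ z, HasSum (fun i : J × J => β i.1 i.2 z) 1

variable {𝕜 : Type*} [RCLike 𝕜]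

/-- The quasi-interpolant `Q_X f = ∑_{j,k} f(x_j, y_k) β_{j,k}`. -/
def quasiInterp (x : J → ℝ) (y : J → Fin d → ℝ) (β : J → J → Plane d → ℝ)
    (f : Plane d → 𝕜) : Plane d → 𝕜 :=
  fun z => ∑' i : J × J, f (x i.1, y i.2) * (β i.1 i.2 z : 𝕜)

/-- The iterates `f₁ = P Q f`, `f_{n+1} = P Q (f - f_n) + f_n`. The iteration starts at index `1`;
index `0` is only a placeholder. -/
def iterate (P Q : (Plane d → 𝕜) → (Plane d → 𝕜)) (f : Plane d → 𝕜) : ℕ → (Plane d → 𝕜)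
  | 0 => 0
  | 1 => P (Q f)
  | n + 2 => P (Q (f - iterate P Q f (n + 1))) + iterate P Q f (n + 1)

end Sampling

end MixedSampling

end

/-! The iteration is a Neumann series: the errors satisfy `f - f_{n+1} = (I - PQ)(f - f_n)`, so it
suffices that `I - PQ` contracts `V_{p,q}(φ)` by a factor 1/2. On that space `g - PQg = P(g - Qg)`,
so boundedness of `P` reduces everything to making `‖g - Qg‖ ≤ η‖g‖` for small `η`
(`IsBoundedProjection.exists_radius`).

For `g = ∑ c(k) φ(· - k)`, compact support leaves only the coefficients `c(⌊z⌋ - j)`, `j` in a fixed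
finite set `K`, in the value at `z`. Uniform continuity of `φ` then bounds the oscillation of `g` at
a small scale by `ε ∑_{j ∈ K} |c(⌊z⌋ - j)|` (`exists_osc_semiConv_le`). Since `z ↦ c(⌊z⌋)` has
`L^{p,q}` norm exactly `‖c‖_{ℓ^{p,q}}`, this gives `‖g - Qg‖ ≤ ε |K| ‖c‖`.

It remains to choose `c` with `‖c‖ ≤ C‖g‖`, although the translates of `φ` are not assumed to be
stable or even independent. The projection supplies this: it makes `V_{p,q}(φ)` complete, so the
bounded surjection `c ↦ g` from `ℓ^{p,q}` is open (`IsBoundedProjection.exists_coeff_le`). The same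
control of coefficients dominates the sup norm by the `L^{p,q}` norm, whence uniform convergence. -/

noncomputable section

namespace MixedSampling

/-! ### Minkowski's inequality for sums -/

section LebesgueNorm

variable {α : Type*} [MeasurableSpace α] {μ : Measure α}

/-- Minkowski's inequality for finite sums of nonnegative functions. -/
theorem lintegral_rpow_sum_le {ι : Type*} (s : Finset ι) {p : ℝ} (hp : 1 ≤ p) {F : ι → α → ℝ≥0∞}
    (hF : ∀ i, AEMeasurable (F i) μ) :
    (∫⁻ a, (∑ i ∈ s, F i a) ^ p ∂μ) ^ (1 / p) ≤ ∑ i ∈ s, (∫⁻ a, F i a ^ p ∂μ) ^ (1 / p) := by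
  classical
  induction s using Finset.induction_on with
  | empty => simp [ENNReal.zero_rpow_of_pos (zero_lt_one.trans_le hp),
      ENNReal.zero_rpow_of_pos (inv_pos.2 (zero_lt_one.trans_le hp))]
  | insert i s hi ih =>
    simp only [Finset.sum_insert hi]
    exact (ENNReal.lintegral_Lp_add_le (hF i)
      (Finset.aemeasurable_fun_sum s fun j _ => hF j) hp).trans (by gcongr)

/-- Minkowski's inequality for countable sums of nonnegative functions. -/
theorem lintegral_rpow_tsum_le {ι : Type*} [Countable ι] {p : ℝ} (hp : 1 ≤ p)
    {F : ι → α → ℝ≥0∞} (hF : ∀ i, AEMeasurable (F i) μ) :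
    (∫⁻ a, (∑' i, F i a) ^ p ∂μ) ^ (1 / p) ≤ ∑' i, (∫⁻ a, F i a ^ p ∂μ) ^ (1 / p) := by
  have hp0 : 0 < p := zero_lt_one.trans_le hp
  have h1 : ∀ a, (∑' i, F i a) ^ p = ⨆ s : Finset ι, (∑ i ∈ s, F i a) ^ p := fun a => by
    rw [ENNReal.tsum_eq_iSup_sum]
    exact (ENNReal.orderIsoRpow p hp0).map_iSup _
  have h2 : ∫⁻ a, (∑' i, F i a) ^ p ∂μ = ⨆ s : Finset ι, ∫⁻ a, (∑ i ∈ s, F i a) ^ p ∂μ := by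
    simp_rw [h1]
    -- Monotone convergence along the countable directed family of finite subsets.
    refine lintegral_iSup_directed
      (fun s => (Finset.aemeasurable_fun_sum s fun j _ => hF j).pow_const p) ?_
    refine Monotone.directed_le fun s t hst a => ?_
    dsimp only
    gcongr
  rw [h2, show (⨆ s : Finset ι, ∫⁻ a, (∑ i ∈ s, F i a) ^ p ∂μ) ^ (1 / p)
    = ⨆ s : Finset ι, (∫⁻ a, (∑ i ∈ s, F i a) ^ p ∂μ) ^ (1 / p) from
      (ENNReal.orderIsoRpow (1 / p) (by positivity)).map_iSup _]
  exact iSup_le fun s => (lintegral_rpow_sum_le s hp hF).trans (ENNReal.sum_le_tsum s)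

end LebesgueNorm

/-! ### The mixed norm on nonnegative functions -/

section MixedLp

variable {d : ℕ} {p q : ℝ}

/-- The mixed Lebesgue norm of a nonnegative function. -/
def mixedLp (p q : ℝ) (F : Plane d → ℝ≥0∞) : ℝ≥0∞ :=
  (∫⁻ x : ℝ, (∫⁻ y : Fin d → ℝ, F (x, y) ^ q) ^ (p / q)) ^ (1 / p)

theorem mixedNorm_eq_mixedLp {𝕜 : Type*} [RCLike 𝕜] (f : Plane d → 𝕜) :
    mixedNorm p q f = mixedLp p q fun z => ‖f z‖ₑ := rfl

/-- As an `L^p` norm of `L^q` norms, the mixed norm inherits Minkowski's inequality by applying it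
in `y` and then in `x`. -/
theorem mixedLp_eq_iterated (F : Plane d → ℝ≥0∞) :
    mixedLp p q F
      = (∫⁻ x : ℝ, ((∫⁻ y : Fin d → ℝ, F (x, y) ^ q) ^ (1 / q)) ^ p) ^ (1 / p) := by
  simp only [mixedLp, ← ENNReal.rpow_mul, one_div_mul_eq_div]

theorem mixedLp_mono_ae (hp : 0 < p) (hq : 0 < q) {F G : Plane d → ℝ≥0∞}
    (h : ∀ᵐ z, F z ≤ G z) : mixedLp p q F ≤ mixedLp p q G := by
  refine ENNReal.rpow_le_rpow (lintegral_mono_ae ?_) (by positivity)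
  filter_upwards [Measure.ae_ae_of_ae_prod h] with x hx
  refine ENNReal.rpow_le_rpow (lintegral_mono_ae ?_) (by positivity)
  filter_upwards [hx] with y hy
  exact ENNReal.rpow_le_rpow hy hq.le

theorem mixedLp_mono (hp : 0 < p) (hq : 0 < q) {F G : Plane d → ℝ≥0∞}
    (h : ∀ z, F z ≤ G z) : mixedLp p q F ≤ mixedLp p q G :=
  mixedLp_mono_ae hp hq (.of_forall h)

theorem mixedLp_congr_ae (hp : 0 < p) (hq : 0 < q) {F G : Plane d → ℝ≥0∞}
    (h : F =ᵐ[volume] G) : mixedLp p q F = mixedLp p q G :=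
  (mixedLp_mono_ae hp hq h.le).antisymm (mixedLp_mono_ae hp hq h.symm.le)

theorem mixedLp_tsum_le {ι : Type*} [Countable ι] (hp : 1 ≤ p) (hq : 1 ≤ q)
    {F : ι → Plane d → ℝ≥0∞} (hF : ∀ i, AEMeasurable (F i)) :
    mixedLp p q (fun z => ∑' i, F i z) ≤ ∑' i, mixedLp p q (F i) := by
  have hp0 : 0 < p := zero_lt_one.trans_le hp
  have hq0 : 0 < q := zero_lt_one.trans_le hq
  -- A measurable modification makes the section at every `x` measurable, as the inner Minkowski
  -- inequality requires.
  wlog hm : ∀ i, Measurable (F i) generalizing F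
  · have h := this (F := fun i => (hF i).mk) (fun i => (hF i).measurable_mk.aemeasurable)
      (fun i => (hF i).measurable_mk)
    rw [mixedLp_congr_ae hp0 hq0 (G := fun z => ∑' i, (hF i).mk (F i) z)]
    · exact h.trans_eq (tsum_congr fun i => (mixedLp_congr_ae hp0 hq0 (hF i).ae_eq_mk).symm)
    · filter_upwards [ae_all_iff.2 fun i => (hF i).ae_eq_mk] with z hz
      exact tsum_congr hz
  simp only [mixedLp_eq_iterated]
  calc _ ≤ (∫⁻ x : ℝ, (∑' i, (∫⁻ y : Fin d → ℝ, F i (x, y) ^ q) ^ (1 / q)) ^ p) ^ (1 / p) := by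
        gcongr with x
        exact lintegral_rpow_tsum_le hq fun i => ((hm i).comp measurable_prodMk_left).aemeasurable
    _ ≤ _ := lintegral_rpow_tsum_le hp fun i =>
        (((hm i).pow_const q).lintegral_prod_right'.pow_const _).aemeasurable

theorem mixedLp_const_mul (hp : 0 < p) (hq : 0 < q) {a : ℝ≥0∞} (ha : a ≠ ∞)
    (F : Plane d → ℝ≥0∞) : mixedLp p q (fun z => a * F z) = a * mixedLp p q F := by
  have h : ∀ s : ℝ, 0 < s → a ^ s ≠ ∞ := fun s hs => (ENNReal.rpow_lt_top_of_nonneg hs.le ha).ne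
  simp only [mixedLp_eq_iterated, ENNReal.mul_rpow_of_nonneg _ _ hq.le,
    lintegral_const_mul' _ _ (h q hq), ENNReal.mul_rpow_of_nonneg _ _ (one_div_pos.2 hq).le,
    ENNReal.mul_rpow_of_nonneg _ _ hp.le, lintegral_const_mul' _ _ (h p hp), ← ENNReal.rpow_mul,
    mul_one_div_cancel hq.ne', ENNReal.rpow_one, ENNReal.mul_rpow_of_nonneg _ _ (one_div_pos.2 hp).le,
    mul_one_div_cancel hp.ne']

theorem mixedLp_add_le (hp : 1 ≤ p) (hq : 1 ≤ q) {F G : Plane d → ℝ≥0∞} (hF : AEMeasurable F)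
    (hG : AEMeasurable G) :
    mixedLp p q (fun z => F z + G z) ≤ mixedLp p q F + mixedLp p q G := by
  have h := mixedLp_tsum_le (ι := Bool) hp hq (F := fun b => cond b F G) (by simp [hF, hG])
  simpa [tsum_fintype] using h

theorem mixedLp_finsetSum_le {ι : Type*} (s : Finset ι) (hp : 1 ≤ p) (hq : 1 ≤ q)
    {F : ι → Plane d → ℝ≥0∞} (hF : ∀ i, AEMeasurable (F i)) :
    mixedLp p q (fun z => ∑ i ∈ s, F i z) ≤ ∑ i ∈ s, mixedLp p q (F i) := by
  have h := mixedLp_tsum_le (ι := s) hp hq (F := fun i => F i) fun i => hF i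
  simpa only [tsum_fintype, Finset.sum_coe_sort s fun i => mixedLp p q (F i),
    fun z => Finset.sum_coe_sort s fun i => F i z] using h

theorem ae_of_ae_ae {F : Plane d → ℝ≥0∞} (hm : Measurable F) {Pr : ℝ≥0∞ → Prop}
    (hPr : MeasurableSet {t | Pr t}) (h : ∀ᵐ x : ℝ, ∀ᵐ y : Fin d → ℝ, Pr (F (x, y))) :
    ∀ᵐ z, Pr (F z) :=
  (Measure.ae_prod_iff_ae_ae (hm hPr)).2 h

theorem ae_lt_top_of_mixedLp_lt_top (hp : 0 < p) (hq : 0 < q) {F : Plane d → ℝ≥0∞}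
    (hF : AEMeasurable F) (h : mixedLp p q F < ∞) : ∀ᵐ z, F z < ∞ := by
  wlog hm : Measurable F generalizing F
  · have := this hF.measurable_mk.aemeasurable
      (by rwa [mixedLp_congr_ae hp hq hF.ae_eq_mk] at h) hF.measurable_mk
    filter_upwards [this, hF.ae_eq_mk] with z h1 h2
    rwa [h2]
  refine ae_of_ae_ae hm (Pr := (· < ∞)) measurableSet_Iio ?_
  rw [mixedLp, ENNReal.rpow_lt_top_iff_of_pos (by positivity)] at h
  filter_upwards [ae_lt_top ((hm.pow_const q).lintegral_prod_right'.pow_const _) h.ne] with x hx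
  rw [ENNReal.rpow_lt_top_iff_of_pos (by positivity)] at hx
  filter_upwards [ae_lt_top ((hm.comp measurable_prodMk_left).pow_const q) hx.ne] with y hy
  rwa [ENNReal.rpow_lt_top_iff_of_pos hq] at hy

theorem ae_eq_zero_of_mixedLp_eq_zero (hp : 0 < p) (hq : 0 < q) {F : Plane d → ℝ≥0∞}
    (hF : AEMeasurable F) (h : mixedLp p q F = 0) : ∀ᵐ z, F z = 0 := by
  wlog hm : Measurable F generalizing F
  · have := this hF.measurable_mk.aemeasurable
      (by rwa [mixedLp_congr_ae hp hq hF.ae_eq_mk] at h) hF.measurable_mk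
    filter_upwards [this, hF.ae_eq_mk] with z h1 h2
    rwa [h2]
  refine ae_of_ae_ae hm (Pr := (· = 0)) (measurableSet_singleton _) ?_
  rw [mixedLp, ENNReal.rpow_eq_zero_iff_of_pos (by positivity),
    lintegral_eq_zero_iff ((hm.pow_const q).lintegral_prod_right'.pow_const _)] at h
  filter_upwards [h] with x hx
  rw [Pi.zero_apply, ENNReal.rpow_eq_zero_iff_of_pos (by positivity),
    lintegral_eq_zero_iff (by fun_prop)] at hx
  filter_upwards [hx] with y hy
  rwa [Pi.zero_apply, ENNReal.rpow_eq_zero_iff_of_pos hq] at hy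

end MixedLp

/-! ### The space `L^{p,q}` and its completeness -/

section MixedNorm

variable {𝕜 : Type*} [RCLike 𝕜] {d : ℕ} {p q : ℝ}

theorem mixedNorm_add_le (hp : 1 ≤ p) (hq : 1 ≤ q) {f g : Plane d → 𝕜}
    (hf : AEStronglyMeasurable f) (hg : AEStronglyMeasurable g) :
    mixedNorm p q (f + g) ≤ mixedNorm p q f + mixedNorm p q g :=
  (mixedLp_mono (by positivity) (by positivity) fun _ => enorm_add_le _ _).trans
    (mixedLp_add_le hp hq hf.enorm hg.enorm)

theorem mixedNorm_smul (hp : 0 < p) (hq : 0 < q) (a : 𝕜) (f : Plane d → 𝕜) :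
    mixedNorm p q (a • f) = ‖a‖ₑ * mixedNorm p q f := by
  simp only [mixedNorm_eq_mixedLp, Pi.smul_apply, smul_eq_mul, enorm_mul]
  exact mixedLp_const_mul hp hq enorm_ne_top _

theorem mixedNorm_neg (f : Plane d → 𝕜) : mixedNorm p q (-f) = mixedNorm p q f := by
  simp [mixedNorm_eq_mixedLp]

namespace MemMixedLp

theorem add (hp : 1 ≤ p) (hq : 1 ≤ q) {f g : Plane d → 𝕜} (hf : MemMixedLp p q f)
    (hg : MemMixedLp p q g) : MemMixedLp p q (f + g) :=
  ⟨hf.1.add hg.1, (mixedNorm_add_le hp hq hf.1 hg.1).trans_lt (ENNReal.add_lt_top.2 ⟨hf.2, hg.2⟩)⟩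

theorem smul (hp : 0 < p) (hq : 0 < q) (a : 𝕜) {f : Plane d → 𝕜} (hf : MemMixedLp p q f) :
    MemMixedLp p q (a • f) :=
  ⟨hf.1.const_smul a, by
    rw [mixedNorm_smul hp hq]
    exact ENNReal.mul_lt_top enorm_lt_top hf.2⟩

theorem neg {f : Plane d → 𝕜} (hf : MemMixedLp p q f) : MemMixedLp p q (-f) :=
  ⟨hf.1.neg, by rw [mixedNorm_neg]; exact hf.2⟩

theorem sub (hp : 1 ≤ p) (hq : 1 ≤ q) {f g : Plane d → 𝕜} (hf : MemMixedLp p q f)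
    (hg : MemMixedLp p q g) : MemMixedLp p q (f - g) := by
  simpa only [sub_eq_add_neg] using hf.add hp hq hg.neg

end MemMixedLp

/-- The Riesz–Fischer property of `L^{p,q}`: absolutely convergent series converge. -/
theorem exists_mixedNorm_sub_sum_le (hp : 1 ≤ p) (hq : 1 ≤ q) {u : ℕ → Plane d → 𝕜}
    (hu : ∀ n, MemMixedLp p q (u n)) (hs : ∑' n, mixedNorm p q (u n) < ∞) :
    ∃ F, MemMixedLp p q F ∧ ∀ n,
      mixedNorm p q (F - ∑ i ∈ Finset.range n, u i) ≤ ∑' i, mixedNorm p q (u (i + n)) := by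
  have hp0 : 0 < p := zero_lt_one.trans_le hp
  have hq0 : 0 < q := zero_lt_one.trans_le hq
  have hmeas : ∀ n, AEMeasurable fun z => ‖u n z‖ₑ := fun n => (hu n).1.enorm
  have hfin : ∀ᵐ z, ∑' n, ‖u n z‖ₑ < ∞ :=
    ae_lt_top_of_mixedLp_lt_top hp0 hq0 (AEMeasurable.tsum hmeas)
      ((mixedLp_tsum_le hp hq hmeas).trans_lt hs)
  have hsum : ∀ᵐ z, Summable fun n => u n z := by
    filter_upwards [hfin] with z hz
    refine Summable.of_norm ?_
    exact NNReal.summable_coe.2 (ENNReal.tsum_coe_ne_top_iff_summable.1 hz.ne)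
  have hFm : AEStronglyMeasurable fun z => ∑' n, u n z := by
    refine aestronglyMeasurable_of_tendsto_ae atTop
      (f := fun n z => ∑ i ∈ Finset.range n, u i z)
      (fun n => Finset.aestronglyMeasurable_fun_sum _ fun i _ => (hu i).1) ?_
    filter_upwards [hsum] with z hz using hz.hasSum.tendsto_sum_nat
  have hle : ∀ n, mixedNorm p q ((fun z => ∑' n, u n z) - ∑ i ∈ Finset.range n, u i)
      ≤ ∑' i, mixedNorm p q (u (i + n)) := fun n => by
    rw [mixedNorm_eq_mixedLp]
    refine le_trans (mixedLp_mono_ae hp0 hq0 ?_)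
      (mixedLp_tsum_le hp hq fun i => hmeas (i + n))
    filter_upwards [hsum] with z hz
    rw [Pi.sub_apply, Finset.sum_apply, ← hz.sum_add_tsum_nat_add n, add_sub_cancel_left]
    exact enorm_tsum_le_tsum_enorm
  refine ⟨fun z => ∑' n, u n z, ⟨hFm, ?_⟩, hle⟩
  simpa using (hle 0).trans_lt hs

end MixedNorm

/-! ### Discretisation by the floor map -/

section Floor

variable {d : ℕ}

/-- The coordinatewise floor. -/
def Plane.floor (z : Plane d) : Lattice d := (⌊z.1⌋, fun i => ⌊z.2 i⌋)

theorem Plane.floor_sub_toPlane (z : Plane d) (k : Lattice d) :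
    (z - k.toPlane).floor = z.floor - k := by
  ext <;> simp [Plane.floor, Lattice.toPlane]

theorem lintegral_comp_floor (h : ℤ → ℝ≥0∞) : ∫⁻ x : ℝ, h ⌊x⌋ = ∑' n, h n := by
  rw [← lintegral_map (f := h) (g := fun x : ℝ => ⌊x⌋) (measurable_of_countable _)
    Int.measurable_floor, lintegral_countable']
  refine tsum_congr fun n => ?_
  rw [Measure.map_apply Int.measurable_floor (measurableSet_singleton n),
    Int.preimage_floor_singleton]
  simp

theorem lintegral_comp_floor_pi (h : (Fin d → ℤ) → ℝ≥0∞) :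
    ∫⁻ y : Fin d → ℝ, h (fun i => ⌊y i⌋) = ∑' l, h l := by
  have hm : Measurable fun (y : Fin d → ℝ) i => ⌊y i⌋ :=
    measurable_pi_lambda _ fun i => Int.measurable_floor.comp (measurable_pi_apply i)
  rw [← lintegral_map (f := h) (measurable_of_countable _) hm, lintegral_countable']
  refine tsum_congr fun l => ?_
  have : (fun (y : Fin d → ℝ) i => ⌊y i⌋) ⁻¹' {l}
      = Set.univ.pi fun i => Set.Ico (l i : ℝ) (l i + 1) := by
    ext y
    simp [funext_iff, Int.floor_eq_iff]
  rw [Measure.map_apply hm (measurableSet_singleton l), this, Real.volume_pi_Ico]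
  simp

variable {𝕜 : Type*} [RCLike 𝕜] {p q : ℝ}

theorem Plane.measurable_floor : Measurable (Plane.floor (d := d)) :=
  (Int.measurable_floor.comp measurable_fst).prodMk
    (measurable_pi_lambda _ fun i =>
      Int.measurable_floor.comp ((measurable_pi_apply i).comp measurable_snd))

/-- The function `c(⌊z⌋)` is constant on lattice cubes of volume one, so both integrals become sums.
-/
theorem mixedLp_comp_floor (c : Lattice d → 𝕜) :
    mixedLp p q (fun z => ‖c z.floor‖ₑ) = seqNorm p q c := by
  simp only [mixedLp, Plane.floor, seqNorm]
  rw [← lintegral_comp_floor fun n => (∑' l : Fin d → ℤ, ‖c (n, l)‖ₑ ^ q) ^ (p / q)]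
  congr! with x
  exact lintegral_comp_floor_pi fun l => ‖c (⌊x⌋, l)‖ₑ ^ q

theorem seqNorm_comp_sub (c : Lattice d → 𝕜) (j : Lattice d) :
    seqNorm p q (fun k => c (k - j)) = seqNorm p q c := by
  simp only [seqNorm]
  congr 1
  rw [← (Equiv.subRight j.1).tsum_eq fun n : ℤ => (∑' l, ‖c (n, l)‖ₑ ^ q) ^ (p / q)]
  congr! 3 with n
  exact (Equiv.subRight j.2).tsum_eq fun l => ‖c (n - j.1, l)‖ₑ ^ q

theorem enorm_le_seqNorm (hp : 0 < p) (hq : 0 < q) (c : Lattice d → 𝕜) (k : Lattice d) :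
    ‖c k‖ₑ ≤ seqNorm p q c := by
  calc ‖c k‖ₑ = ((‖c k‖ₑ ^ q) ^ (p / q)) ^ (1 / p) := by
        rw [← ENNReal.rpow_mul, ← ENNReal.rpow_mul]
        field_simp
        simp
    _ ≤ ((∑' l, ‖c (k.1, l)‖ₑ ^ q) ^ (p / q)) ^ (1 / p) := by
        gcongr
        exact ENNReal.le_tsum (f := fun l => ‖c (k.1, l)‖ₑ ^ q) k.2
    _ ≤ _ := by
        rw [seqNorm]
        gcongr
        exact ENNReal.le_tsum (f := fun n => (∑' l, ‖c (n, l)‖ₑ ^ q) ^ (p / q)) k.1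

/-- Turns pointwise bounds by nearby coefficients into norm bounds: each of the `K.card` translates
of `c` has the norm of `c`. -/
theorem mixedLp_sum_floor_le (hp : 1 ≤ p) (hq : 1 ≤ q) (a : ℝ≥0) (K : Finset (Lattice d))
    (c : Lattice d → 𝕜) :
    mixedLp p q (fun z => a * ∑ j ∈ K, ‖c (z.floor - j)‖ₑ)
      ≤ (a * K.card : ℝ≥0) * seqNorm p q c := by
  rw [mixedLp_const_mul (by positivity) (by positivity) ENNReal.coe_ne_top]
  have hm : ∀ j, Measurable fun z : Plane d => ‖c (z.floor - j)‖ₑ := fun j =>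
    (measurable_of_countable fun k : Lattice d => ‖c (k - j)‖ₑ).comp Plane.measurable_floor
  calc _ ≤ a * ∑ j ∈ K, mixedLp p q (fun z => ‖c (z.floor - j)‖ₑ) := by
        gcongr
        exact mixedLp_finsetSum_le K hp hq fun j => (hm j).aemeasurable
    _ = _ := by
        have : ∀ j, mixedLp p q (fun z => ‖c (z.floor - j)‖ₑ) = seqNorm p q c := fun j => by
          rw [mixedLp_comp_floor fun k => c (k - j), seqNorm_comp_sub]
        simp [this, mul_assoc]

theorem sum_floor_le (hp : 0 < p) (hq : 0 < q) (a : ℝ≥0) (K : Finset (Lattice d))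
    (c : Lattice d → 𝕜) (z : Plane d) :
    a * ∑ j ∈ K, ‖c (z.floor - j)‖ₑ ≤ (a * K.card : ℝ≥0) * seqNorm p q c := by
  calc _ ≤ a * ∑ j ∈ K, seqNorm p q c := by
        gcongr
        exact enorm_le_seqNorm hp hq c _
    _ = _ := by simp [mul_assoc]

theorem exists_finset_floor_mem {s : Set (Plane d)} (hs : Bornology.IsBounded s) :
    ∃ K : Finset (Lattice d), ∀ z ∈ s, z.floor ∈ K := by
  obtain ⟨R, hR⟩ := hs.exists_norm_le
  refine ⟨Finset.Icc (-⌈R⌉) ⌈R⌉ ×ˢ Finset.Icc (fun _ => -⌈R⌉) (fun _ => ⌈R⌉), fun z hz => ?_⟩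
  have key : ∀ t : ℝ, |t| ≤ R → -⌈R⌉ ≤ ⌊t⌋ ∧ ⌊t⌋ ≤ ⌈R⌉ := fun t ht => by
    obtain ⟨h1, h2⟩ := abs_le.1 ht
    have h3 := Int.le_ceil R
    refine ⟨Int.le_floor.2 ?_, ?_⟩
    · push_cast
      linarith
    · exact_mod_cast (Int.floor_le t).trans (h2.trans h3)
  have h1 : |z.1| ≤ R := (norm_fst_le z).trans (hR z hz)
  have h2 : ∀ i, |z.2 i| ≤ R := fun i =>
    (norm_le_pi_norm z.2 i).trans ((norm_snd_le z).trans (hR z hz))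
  simp only [Finset.mem_product, Finset.mem_Icc, Plane.floor, Pi.le_def]
  exact ⟨key _ h1, fun i => (key _ (h2 i)).1, fun i => (key _ (h2 i)).2⟩

end Floor

/-! ### Size, oscillation and continuity of semi-discrete convolutions -/

section SemiConv

variable {𝕜 : Type*} [RCLike 𝕜] {d : ℕ} {p q : ℝ}

/-- Substituting `k = ⌊z⌋ - j` gives `⌊z - k⌋ = j`, so the surviving terms are indexed by `K`,
independently of `z`. -/
theorem semiConv_eq_sum {K : Finset (Lattice d)} {φ : Plane d → 𝕜}
    (hK : ∀ w, φ w ≠ 0 → w.floor ∈ K) (c : Lattice d → 𝕜) (z : Plane d) :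
    semiConv c φ z = ∑ j ∈ K, c (z.floor - j) * φ (z - (z.floor - j).toPlane) := by
  rw [semiConv, ← (Equiv.subLeft z.floor).tsum_eq]
  refine tsum_eq_sum fun j hj => ?_
  rw [Equiv.subLeft_apply, mul_eq_zero]
  right
  by_contra h
  have := hK _ h
  rw [Plane.floor_sub_toPlane, sub_sub_cancel] at this
  exact hj this

theorem enorm_semiConv_le {K : Finset (Lattice d)} {φ : Plane d → 𝕜}
    (hK : ∀ w, φ w ≠ 0 → w.floor ∈ K) {a : ℝ≥0} (ha : ∀ w, ‖φ w‖ₑ ≤ a) (c : Lattice d → 𝕜)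
    (z : Plane d) : ‖semiConv c φ z‖ₑ ≤ a * ∑ j ∈ K, ‖c (z.floor - j)‖ₑ := by
  rw [semiConv_eq_sum hK, Finset.mul_sum]
  refine (enorm_sum_le _ _).trans (Finset.sum_le_sum fun j _ => ?_)
  rw [enorm_mul, mul_comm]
  gcongr
  exact ha _

/-- The floors of all points of a fixed neighbourhood of the support lie in a finite set. -/
theorem exists_finset_floor_mem_of_hasCompactSupport {φ : Plane d → 𝕜}
    (hφc : HasCompactSupport φ) :
    ∃ K : Finset (Lattice d), ∀ h : Plane d, ‖h‖ ≤ 1 → ∀ w, φ (w + h) ≠ 0 → w.floor ∈ K := by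
  obtain ⟨K, hK⟩ := exists_finset_floor_mem (hφc.isCompact.isBounded.cthickening (δ := 1))
  refine ⟨K, fun h hh w hw => hK w (Metric.mem_cthickening_of_dist_le w (w + h) 1 _
    (subset_tsupport _ hw) ?_)⟩
  simpa [dist_eq_norm] using hh

theorem exists_enorm_le_of_hasCompactSupport {φ : Plane d → 𝕜} (hφ : Continuous φ)
    (hφc : HasCompactSupport φ) : ∃ a : ℝ≥0, ∀ w, ‖φ w‖ₑ ≤ a := by
  obtain ⟨C, hC⟩ := hφc.exists_bound_of_continuous hφ
  exact ⟨C.toNNReal, fun w => by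
    rw [← ofReal_norm]
    exact ENNReal.ofReal_le_ofReal (hC w)⟩

/-- Oscillation estimate for semi-discrete convolutions with a compactly supported generator. -/
theorem exists_osc_semiConv_le {φ : Plane d → 𝕜} (hφ : Continuous φ)
    (hφc : HasCompactSupport φ) :
    ∃ K : Finset (Lattice d), ∀ ε : ℝ≥0, 0 < ε → ∃ r : ℝ, 0 < r ∧ ∀ (c : Lattice d → 𝕜) (z w),
      ‖z - w‖ < r →
        ‖semiConv c φ z - semiConv c φ w‖ₑ ≤ ε * ∑ j ∈ K, ‖c (z.floor - j)‖ₑ := by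
  obtain ⟨K, hK⟩ := exists_finset_floor_mem_of_hasCompactSupport hφc
  refine ⟨K, fun ε hε => ?_⟩
  obtain ⟨δ, hδ, h⟩ := Metric.uniformContinuous_iff.1
    (hφc.uniformContinuous_of_continuous hφ) ε hε
  -- The cap at 1 keeps the generator shifted by `w - z` within the reach of the same set `K`.
  refine ⟨min δ 1, by positivity, fun c z w hzw => ?_⟩
  have hK' : ∀ v, (fun v => φ v - φ (v + (w - z))) v ≠ 0 → v.floor ∈ K := fun v hv => by
    by_cases h0 : φ v = 0
    · refine hK (w - z) ?_ v fun h1 => hv (by simp [h0, h1])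
      rw [norm_sub_rev]
      exact (hzw.trans_le (min_le_right _ _)).le
    · exact hK 0 (by simp) v (by simpa using h0)
  have hKφ : ∀ v, φ v ≠ 0 → v.floor ∈ K := fun v hv => hK 0 (by simp) v (by simpa using hv)
  have hKt : ∀ v, (fun v => φ (v + (w - z))) v ≠ 0 → v.floor ∈ K := fun v hv =>
    hK (w - z) (by rw [norm_sub_rev]; exact (hzw.trans_le (min_le_right _ _)).le) v hv
  have hw : semiConv c φ w = semiConv c (fun v => φ (v + (w - z))) z := by
    simp only [semiConv]
    congr! 4
    abel
  -- The increment is itself a semi-discrete convolution at `z`, with generator `φ - φ(· + (w -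
  -- z))`, which is uniformly smaller than `ε`.
  have hsub : semiConv c φ z - semiConv c φ w
      = semiConv c (fun v => φ v - φ (v + (w - z))) z := by
    rw [hw, semiConv_eq_sum hKφ, semiConv_eq_sum hKt, semiConv_eq_sum hK',
      ← Finset.sum_sub_distrib]
    simp only [mul_sub]
  rw [hsub]
  refine enorm_semiConv_le hK' (fun v => ?_) c z
  rw [← ofReal_norm, ← ENNReal.ofReal_coe_nnreal]
  refine ENNReal.ofReal_le_ofReal (le_of_lt ?_)
  rw [← dist_eq_norm]
  refine h ?_
  rw [dist_eq_norm, sub_add_cancel_left, norm_neg, norm_sub_rev]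
  exact hzw.trans_le (min_le_left _ _)

theorem exists_semiConv_bound (hp : 1 ≤ p) (hq : 1 ≤ q) {φ : Plane d → 𝕜} (hφ : Continuous φ)
    (hφc : HasCompactSupport φ) :
    ∃ A : ℝ≥0, ∀ c : Lattice d → 𝕜, mixedNorm p q (semiConv c φ) ≤ A * seqNorm p q c ∧
      ∀ z, ‖semiConv c φ z‖ₑ ≤ A * seqNorm p q c := by
  obtain ⟨K, hK⟩ := exists_finset_floor_mem_of_hasCompactSupport hφc
  obtain ⟨a, ha⟩ := exists_enorm_le_of_hasCompactSupport hφ hφc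
  have hKφ : ∀ v, φ v ≠ 0 → v.floor ∈ K := fun v hv => hK 0 (by simp) v (by simpa using hv)
  refine ⟨a * K.card, fun c => ⟨?_, fun z => ?_⟩⟩
  · exact (mixedLp_mono (by positivity) (by positivity) (enorm_semiConv_le hKφ ha c)).trans
      (mixedLp_sum_floor_le hp hq a K c)
  · exact (enorm_semiConv_le hKφ ha c z).trans
      (sum_floor_le (by positivity) (by positivity) a K c z)

theorem continuous_semiConv (hp : 1 ≤ p) (hq : 1 ≤ q) {φ : Plane d → 𝕜} (hφ : Continuous φ)
    (hφc : HasCompactSupport φ) {c : Lattice d → 𝕜} (hc : seqNorm p q c < ∞) :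
    Continuous (semiConv c φ) := by
  obtain ⟨K, hK⟩ := exists_osc_semiConv_le hφ hφc
  refine Metric.continuous_iff.2 fun z ε hε => ?_
  lift ε to ℝ≥0 using hε.le
  have hε' : (0 : ℝ≥0) < ε := by exact_mod_cast hε
  set B := K.card * (seqNorm p q c).toNNReal with hB
  -- `B` bounds the coefficient sum at every point; `B + 1` avoids dividing by zero.
  obtain ⟨r, hr, h⟩ := hK (ε / (B + 1)) (by positivity)
  refine ⟨r, hr, fun w hw => ?_⟩
  rw [dist_comm, dist_eq_norm] at hw
  have h1 : ‖semiConv c φ z - semiConv c φ w‖ₑ ≤ (ε / (B + 1) * B : ℝ≥0) := by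
    refine (h c z w hw).trans
      ((sum_floor_le (p := p) (q := q) (by positivity) (by positivity) _ K c z).trans_eq ?_)
    rw [hB, ← ENNReal.coe_toNNReal hc.ne, ← ENNReal.coe_mul, ENNReal.coe_toNNReal hc.ne, mul_assoc]
  have h2 : ε / (B + 1) * B < ε := by
    rw [div_mul_eq_mul_div, div_lt_iff₀ (by positivity)]
    gcongr
    exact lt_add_one B
  rw [dist_comm, dist_eq_norm]
  have h3 : ‖semiConv c φ z - semiConv c φ w‖₊ ≤ ε / (B + 1) * B := by exact_mod_cast h1
  exact_mod_cast h3.trans_lt h2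

theorem semiConv_add {φ : Plane d → 𝕜} (hφc : HasCompactSupport φ) (c c' : Lattice d → 𝕜) :
    semiConv (c + c') φ = semiConv c φ + semiConv c' φ := by
  obtain ⟨K, hK⟩ := exists_finset_floor_mem_of_hasCompactSupport hφc
  have hKφ : ∀ v, φ v ≠ 0 → v.floor ∈ K := fun v hv => hK 0 (by simp) v (by simpa using hv)
  ext z
  simp [semiConv_eq_sum hKφ, add_mul, Finset.sum_add_distrib]

theorem semiConv_smul (φ : Plane d → 𝕜) (a : 𝕜) (c : Lattice d → 𝕜) :
    semiConv (a • c) φ = a • semiConv c φ := by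
  ext z
  simp [semiConv, mul_assoc, tsum_mul_left]

theorem memMixedLp_of_mem_shiftInvariant (hp : 1 ≤ p) (hq : 1 ≤ q) {φ : Plane d → 𝕜}
    (hφ : Continuous φ) (hφc : HasCompactSupport φ) {f : Plane d → 𝕜}
    (hf : f ∈ shiftInvariant p q φ) : MemMixedLp p q f := by
  obtain ⟨c, hc, rfl⟩ := hf
  obtain ⟨A, hA⟩ := exists_semiConv_bound hp hq hφ hφc
  exact ⟨(continuous_semiConv hp hq hφ hφc hc).aestronglyMeasurable,
    (hA c).1.trans_lt (ENNReal.mul_lt_top ENNReal.coe_lt_top hc)⟩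

theorem continuous_of_mem_shiftInvariant (hp : 1 ≤ p) (hq : 1 ≤ q) {φ : Plane d → 𝕜}
    (hφ : Continuous φ) (hφc : HasCompactSupport φ) {f : Plane d → 𝕜}
    (hf : f ∈ shiftInvariant p q φ) : Continuous f := by
  obtain ⟨c, hc, rfl⟩ := hf
  exact continuous_semiConv hp hq hφ hφc hc

end SemiConv

/-! ### Open mapping and the Banach space `ℓ^{p,q}` -/

/-- The open mapping theorem for a target whose norm is given as a function, and whose completeness
is given as convergence of absolutely convergent series. -/
theorem exists_preimage_le_of_core {𝕜 E F : Type*} [RCLike 𝕜] [NormedAddCommGroup E]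
    [NormedSpace 𝕜 E] [CompleteSpace E] [AddCommGroup F] [Module 𝕜 F] (N : F → ℝ)
    (nonneg : ∀ v, 0 ≤ N v) (smul : ∀ (a : 𝕜) v, N (a • v) = ‖a‖ * N v)
    (triangle : ∀ v w, N (v + w) ≤ N v + N w) (eq_zero : ∀ v, N v = 0 → v = 0)
    (complete : ∀ u : ℕ → F, (Summable fun n => N (u n)) →
      ∃ s, Tendsto (fun n => N (∑ i ∈ Finset.range n, u i - s)) atTop (𝓝 0))
    (T : E →ₗ[𝕜] F) (hT : Function.Surjective T) {A : ℝ} (bound : ∀ e, N (T e) ≤ A * ‖e‖) :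
    ∃ C > 0, ∀ v, ∃ e, T e = v ∧ ‖e‖ ≤ C * N v := by
  let : Norm F := ⟨N⟩
  have core : NormedSpace.Core 𝕜 F :=
    { norm_nonneg := nonneg
      norm_smul := smul
      norm_triangle := triangle
      norm_eq_zero_iff := fun v => ⟨eq_zero v, by
        rintro rfl
        have := smul 0 0
        rwa [zero_smul, norm_zero, zero_mul] at this⟩ }
  let : NormedAddCommGroup F := .ofCore core
  let : NormedSpace 𝕜 F := .ofCore core
  have : CompleteSpace F := by
    refine NormedAddCommGroup.completeSpace_of_summable_imp_tendsto fun u hu => ?_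
    obtain ⟨s, hs⟩ := complete u hu
    exact ⟨s, tendsto_iff_norm_sub_tendsto_zero.2 hs⟩
  exact (T.mkContinuous A bound).exists_preimage_norm_le hT

section LittleLp

variable {ι : Type*} {E : Type*} [NormedAddCommGroup E] {p : ℝ}

theorem memℓp_iff_tsum_enorm_lt_top (hp : 0 < p) (f : ι → E) :
    Memℓp f (ENNReal.ofReal p) ↔ ∑' i, ‖f i‖ₑ ^ p < ∞ := by
  have h : ∀ i, ‖f i‖ₑ ^ p = ENNReal.ofReal (‖f i‖ ^ p) := fun i => by
    rw [← ofReal_norm, ENNReal.ofReal_rpow_of_nonneg (norm_nonneg _) hp.le]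
  rw [memℓp_gen_iff (by rwa [ENNReal.toReal_ofReal hp.le]), ENNReal.toReal_ofReal hp.le]
  simp_rw [h]
  refine ⟨fun hs => hs.tsum_ofReal_ne_top.lt_top, fun hs => ?_⟩
  refine (ENNReal.summable_toReal hs.ne).congr fun i => ?_
  rw [ENNReal.toReal_ofReal (by positivity)]

theorem lp_enorm_eq_tsum_rpow (hp : 0 < p) [Fact (1 ≤ ENNReal.ofReal p)]
    (f : lp (fun _ : ι => E) (ENNReal.ofReal p)) :
    ‖f‖ₑ = (∑' i, ‖f i‖ₑ ^ p) ^ (1 / p) := by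
  have h : ∀ i, ‖f i‖ₑ ^ p = ENNReal.ofReal (‖f i‖ ^ p) := fun i => by
    rw [← ofReal_norm, ENNReal.ofReal_rpow_of_nonneg (norm_nonneg _) hp.le]
  have hs : Summable fun i => ‖f i‖ ^ p := by
    have := lp.memℓp f
    rwa [memℓp_gen_iff (by rwa [ENNReal.toReal_ofReal hp.le]), ENNReal.toReal_ofReal hp.le] at this
  rw [← ofReal_norm, lp.norm_eq_tsum_rpow (by rwa [ENNReal.toReal_ofReal hp.le]), ENNReal.toReal_ofReal hp.le]
  simp_rw [h]
  rw [← ENNReal.ofReal_tsum_of_nonneg (fun i => by positivity) hs,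
    ENNReal.ofReal_rpow_of_nonneg (tsum_nonneg fun i => by positivity) (by positivity)]

end LittleLp

section MixedSeq

variable (𝕜 : Type*) [RCLike 𝕜] (d : ℕ) (p q : ℝ) [Fact (1 ≤ ENNReal.ofReal q)]

/-- The mixed sequence space `ℓ^{p,q}` as an `ℓ^p`-space with values in an `ℓ^q`-space. -/
abbrev MixedSeq : Type _ :=
  lp (fun _ : ℤ => lp (fun _ : Fin d → ℤ => 𝕜) (ENNReal.ofReal q)) (ENNReal.ofReal p)

variable {𝕜 d p q}

/-- An element of `ℓ^{p,q}` as a function on the lattice. -/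
def MixedSeq.coeff (a : MixedSeq 𝕜 d p q) : Lattice d → 𝕜 := fun k => a k.1 k.2

theorem MixedSeq.exists_coeff_eq (hp : 0 < p) (hq : 0 < q) {c : Lattice d → 𝕜}
    (hc : seqNorm p q c < ∞) : ∃ a : MixedSeq 𝕜 d p q, a.coeff = c := by
  rw [seqNorm, ENNReal.rpow_lt_top_iff_of_pos (by positivity)] at hc
  have hrow : ∀ n, Memℓp (fun l => c (n, l)) (ENNReal.ofReal q) := fun n => by
    rw [memℓp_iff_tsum_enorm_lt_top hq]
    exact (ENNReal.rpow_lt_top_iff_of_pos (by positivity)).1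
      ((ENNReal.le_tsum (f := fun n => (∑' l, ‖c (n, l)‖ₑ ^ q) ^ (p / q)) n).trans_lt hc)
  let b : ℤ → lp (fun _ : Fin d → ℤ => 𝕜) (ENNReal.ofReal q) := fun n => ⟨_, hrow n⟩
  have hb : Memℓp b (ENNReal.ofReal p) := by
    rw [memℓp_iff_tsum_enorm_lt_top hp]
    simpa only [lp_enorm_eq_tsum_rpow hq, ← ENNReal.rpow_mul, one_div_mul_eq_div] using hc
  exact ⟨⟨b, hb⟩, rfl⟩

variable [Fact (1 ≤ ENNReal.ofReal p)]

theorem MixedSeq.seqNorm_coeff (hp : 0 < p) (hq : 0 < q) (a : MixedSeq 𝕜 d p q) :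
    seqNorm p q a.coeff = ‖a‖ₑ := by
  rw [lp_enorm_eq_tsum_rpow hp]
  simp only [lp_enorm_eq_tsum_rpow hq, ← ENNReal.rpow_mul, one_div_mul_eq_div]
  rfl

/-- The synthesis operator of a compactly supported generator. -/
def synthesis {φ : Plane d → 𝕜} (hφc : HasCompactSupport φ) :
    MixedSeq 𝕜 d p q →ₗ[𝕜] (Plane d → 𝕜) where
  toFun a := semiConv a.coeff φ
  map_add' a b := semiConv_add hφc a.coeff b.coeff
  map_smul' t a := semiConv_smul φ t a.coeff

theorem mem_range_synthesis (hp : 0 < p) (hq : 0 < q) {φ : Plane d → 𝕜}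
    (hφc : HasCompactSupport φ) {f : Plane d → 𝕜} :
    f ∈ LinearMap.range (synthesis (p := p) (q := q) hφc) ↔ f ∈ shiftInvariant p q φ := by
  constructor
  · rintro ⟨a, rfl⟩
    exact ⟨a.coeff, (a.seqNorm_coeff hp hq).trans_lt enorm_lt_top, rfl⟩
  · rintro ⟨c, hc, rfl⟩
    obtain ⟨a, rfl⟩ := MixedSeq.exists_coeff_eq hp hq hc
    exact ⟨a, rfl⟩

end MixedSeq

/-! ### Completeness of the shift-invariant space and control of coefficients -/

section ShiftInvariant

variable {𝕜 : Type*} [RCLike 𝕜] {d : ℕ} {p q : ℝ}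

theorem exists_submodule_coe_eq_shiftInvariant (hp : 1 ≤ p) (hq : 1 ≤ q) {φ : Plane d → 𝕜}
    (hφc : HasCompactSupport φ) :
    ∃ V : Submodule 𝕜 (Plane d → 𝕜), ∀ f, f ∈ V ↔ f ∈ shiftInvariant p q φ := by
  have : Fact (1 ≤ ENNReal.ofReal p) := ⟨ENNReal.one_le_ofReal.2 hp⟩
  have : Fact (1 ≤ ENNReal.ofReal q) := ⟨ENNReal.one_le_ofReal.2 hq⟩
  exact ⟨_, fun f => mem_range_synthesis (by positivity) (by positivity) hφc⟩

theorem IsBoundedProjection.map_sub (hp : 1 ≤ p) (hq : 1 ≤ q) {φ : Plane d → 𝕜}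
    {P : (Plane d → 𝕜) → (Plane d → 𝕜)} (hP : IsBoundedProjection p q φ P) {f g : Plane d → 𝕜}
    (hf : MemMixedLp p q f) (hg : MemMixedLp p q g) : P (f - g) = P f - P g := by
  rw [sub_eq_add_neg, ← neg_one_smul 𝕜 g,
    hP.map_add f _ hf (hg.smul (by positivity) (by positivity) _), hP.map_smul _ g hg,
    neg_one_smul, ← sub_eq_add_neg]

/-- A complemented shift-invariant space is complete. -/
theorem IsBoundedProjection.exists_tendsto_sum (hp : 1 ≤ p) (hq : 1 ≤ q) {φ : Plane d → 𝕜}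
    (hφ : Continuous φ) (hφc : HasCompactSupport φ) {P : (Plane d → 𝕜) → (Plane d → 𝕜)}
    (hP : IsBoundedProjection p q φ P) {u : ℕ → Plane d → 𝕜}
    (hu : ∀ n, u n ∈ shiftInvariant p q φ) (hsum : ∑' n, mixedNorm p q (u n) < ∞) :
    ∃ s ∈ shiftInvariant p q φ,
      Tendsto (fun n => mixedNorm p q (∑ i ∈ Finset.range n, u i - s)) atTop (𝓝 0) := by
  obtain ⟨V, hV⟩ := exists_submodule_coe_eq_shiftInvariant hp hq hφc
  obtain ⟨B, hB⟩ := hP.bounded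
  obtain ⟨F, hF, hle⟩ := exists_mixedNorm_sub_sum_le hp hq
    (fun n => memMixedLp_of_mem_shiftInvariant hp hq hφ hφc (hu n)) hsum
  -- The limit `F` in `L^{p,q}` is projected back into the space. As `P` fixes the partial sums,
  -- this costs only the factor `B`.
  refine ⟨P F, hP.mem F hF, ?_⟩
  have hlim : Tendsto (fun n => B * ∑' i, mixedNorm p q (u (i + n))) atTop (𝓝 0) := by
    simpa using ENNReal.Tendsto.const_mul (ENNReal.tendsto_sum_nat_add _ hsum.ne)
      (.inr ENNReal.coe_ne_top)
  refine tendsto_of_tendsto_of_tendsto_of_le_of_le tendsto_const_nhds hlim (fun _ => zero_le)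
    fun n => ?_
  have hS : ∑ i ∈ Finset.range n, u i ∈ shiftInvariant p q φ :=
    (hV _).1 (V.sum_mem fun i _ => (hV _).2 (hu i))
  have hSm := memMixedLp_of_mem_shiftInvariant hp hq hφ hφc hS
  calc mixedNorm p q (∑ i ∈ Finset.range n, u i - P F)
      = mixedNorm p q (P (F - ∑ i ∈ Finset.range n, u i)) := by
        rw [hP.map_sub hp hq hF hSm, hP.fixes _ hS, ← neg_sub, mixedNorm_neg]
    _ ≤ B * mixedNorm p q (F - ∑ i ∈ Finset.range n, u i) := hB _ (hF.sub hp hq hSm)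
    _ ≤ _ := by
      gcongr
      exact hle n

/-- Elements of a complemented shift-invariant space are synthesised from coefficients that are
controlled by their norm. -/
theorem IsBoundedProjection.exists_coeff_le (hp : 1 ≤ p) (hq : 1 ≤ q) {φ : Plane d → 𝕜}
    (hφ : Continuous φ) (hφc : HasCompactSupport φ) {P : (Plane d → 𝕜) → (Plane d → 𝕜)}
    (hP : IsBoundedProjection p q φ P) :
    ∃ C : ℝ≥0, ∀ g ∈ shiftInvariant p q φ, ∃ c : Lattice d → 𝕜,
      g = semiConv c φ ∧ seqNorm p q c ≤ C * mixedNorm p q g := by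
  have hp0 : 0 < p := zero_lt_one.trans_le hp
  have hq0 : 0 < q := zero_lt_one.trans_le hq
  have : Fact (1 ≤ ENNReal.ofReal p) := ⟨ENNReal.one_le_ofReal.2 hp⟩
  have : Fact (1 ≤ ENNReal.ofReal q) := ⟨ENNReal.one_le_ofReal.2 hq⟩
  let T := synthesis (p := p) (q := q) hφc
  let V := LinearMap.range T
  have hV : ∀ f, f ∈ V ↔ f ∈ shiftInvariant p q φ := fun f => mem_range_synthesis hp0 hq0 hφc
  have hmem : ∀ v : V, MemMixedLp p q (v : Plane d → 𝕜) := fun v =>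
    memMixedLp_of_mem_shiftInvariant hp hq hφ hφc ((hV _).1 v.2)
  obtain ⟨A, hA⟩ := exists_semiConv_bound hp hq hφ hφc
  obtain ⟨B, hB⟩ := hP.bounded
  obtain ⟨C, hC, h⟩ := exists_preimage_le_of_core (𝕜 := 𝕜)
    (fun v : V => (mixedNorm p q (v : Plane d → 𝕜)).toReal) (fun v => ENNReal.toReal_nonneg)
    (fun a v => by simp [mixedNorm_smul hp0 hq0])
    (fun v w => by
      rw [← ENNReal.toReal_add (hmem v).2.ne (hmem w).2.ne]
      exact ENNReal.toReal_mono (ENNReal.add_lt_top.2 ⟨(hmem v).2, (hmem w).2⟩).ne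
        (mixedNorm_add_le hp hq (hmem v).1 (hmem w).1))
    (fun v hv => by
      have h0 : mixedNorm p q (v : Plane d → 𝕜) = 0 :=
        (ENNReal.toReal_eq_zero_iff _).1 hv |>.resolve_right (hmem v).2.ne
      have h1 := ae_eq_zero_of_mixedLp_eq_zero hp0 hq0 (hmem v).1.enorm h0
      -- Elements of the range are functions, not classes; continuity upgrades vanishing almost
      -- everywhere to vanishing everywhere.
      refine Subtype.ext ((Continuous.ae_eq_iff_eq (volume : Measure (Plane d))
        (continuous_of_mem_shiftInvariant hp hq hφ hφc ((hV _).1 v.2)) continuous_zero).1 ?_)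
      filter_upwards [h1] with z hz
      simpa using hz)
    (fun u hu => by
      have hsum : ∑' n, mixedNorm p q (u n : Plane d → 𝕜) < ∞ := by
        have := hu.tsum_ofReal_ne_top
        simp only [ENNReal.ofReal_toReal (hmem _).2.ne] at this
        exact this.lt_top
      obtain ⟨s, hs, hlim⟩ := hP.exists_tendsto_sum hp hq hφ hφc (fun n => (hV _).1 (u n).2) hsum
      refine ⟨⟨s, (hV _).2 hs⟩, ?_⟩
      simpa [Function.comp_def] using (ENNReal.tendsto_toReal ENNReal.zero_ne_top).comp hlim)
    T.rangeRestrict T.surjective_rangeRestrict (A := A)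
    (fun a => by
      have h1 := (hA a.coeff).1
      rw [a.seqNorm_coeff hp0 hq0] at h1
      refine (ENNReal.toReal_mono (by finiteness) h1).trans_eq ?_
      simp)
  refine ⟨C.toNNReal, fun g hg => ?_⟩
  obtain ⟨a, ha, hle⟩ := h ⟨g, (hV g).2 hg⟩
  refine ⟨a.coeff, congrArg Subtype.val ha.symm, ?_⟩
  rw [a.seqNorm_coeff hp0 hq0, ← ofReal_norm]
  refine (ENNReal.ofReal_le_ofReal hle).trans_eq ?_
  rw [ENNReal.ofReal_mul hC.le,
    ENNReal.ofReal_toReal (memMixedLp_of_mem_shiftInvariant hp hq hφ hφc hg).2.ne]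
  rfl

end ShiftInvariant

/-! ### Quasi-interpolants of bounded functions -/

section QuasiInterpolation

variable {𝕜 : Type*} [RCLike 𝕜] {d : ℕ} {p q : ℝ} {J : Type*}

theorem norm_sub_lt_of_mem_euclBall {a z : Plane d} {r : ℝ} (h : z ∈ euclBall a r) :
    ‖z - a‖ < r := by
  have h1 : ∀ t : ℝ, t ^ 2 ≤ (z.1 - a.1) ^ 2 + ∑ i, (z.2 i - a.2 i) ^ 2 → |t| < r := fun t ht =>
    (Real.abs_le_sqrt ht).trans_lt h
  have h0 : 0 ≤ ∑ i, (z.2 i - a.2 i) ^ 2 := Finset.sum_nonneg fun i _ => sq_nonneg _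
  have hr : 0 < r := (Real.sqrt_nonneg _).trans_lt h
  refine max_lt (h1 _ (by simpa using h0)) ((pi_norm_lt_iff hr).2 fun i => h1 _ ?_)
  have := Finset.single_le_sum (f := fun i => (z.2 i - a.2 i) ^ 2) (fun i _ => sq_nonneg _)
    (Finset.mem_univ i)
  have h2 := sq_nonneg (z.1 - a.1)
  simp only [Prod.snd_sub, Pi.sub_apply]
  linarith

variable {r : ℝ} {x : J → ℝ} {y : J → Fin d → ℝ} {β : J → J → Plane d → ℝ}

theorem IsBUPU.summable_mul (hβ : IsBUPU r x y β) {g : Plane d → 𝕜} {B : ℝ}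
    (hg : ∀ z, ‖g z‖ ≤ B) (z : Plane d) :
    Summable fun i : J × J => g (x i.1, y i.2) * (β i.1 i.2 z : 𝕜) := by
  refine .of_norm_bounded ((hβ.hasSum_one z).summable.mul_left B) fun i => ?_
  rw [norm_mul, RCLike.norm_ofReal, abs_of_nonneg (hβ.nonneg _ _ _)]
  exact mul_le_mul_of_nonneg_right (hg _) (hβ.nonneg _ _ _)

/-- As the weights sum to one, the error at `z` is an average of the differences `g z - g (x j, y
k)`, and only sampling points within `r` of `z` carry weight. -/
theorem IsBUPU.enorm_sub_quasiInterp_le (hβ : IsBUPU r x y β) {g : Plane d → 𝕜} {B : ℝ}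
    (hg : ∀ z, ‖g z‖ ≤ B) {z : Plane d} {G : ℝ≥0∞}
    (hG : ∀ w, ‖z - w‖ < r → ‖g z - g w‖ₑ ≤ G) : ‖g z - quasiInterp x y β g z‖ₑ ≤ G := by
  have h1 : HasSum (fun i : J × J => (β i.1 i.2 z : 𝕜)) 1 := by
    simpa using (RCLike.hasSum_ofReal 𝕜).2 (hβ.hasSum_one z)
  have h2 : g z - quasiInterp x y β g z
      = ∑' i : J × J, (g z - g (x i.1, y i.2)) * (β i.1 i.2 z : 𝕜) := by
    simp only [sub_mul]
    rw [(h1.summable.mul_left _).tsum_sub (hβ.summable_mul hg z), tsum_mul_left, h1.tsum_eq,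
      mul_one, quasiInterp]
  have h3 : ∑' i : J × J, ‖(β i.1 i.2 z : 𝕜)‖ₑ = 1 := by
    have h4 : ∀ i : J × J, ‖(β i.1 i.2 z : 𝕜)‖ₑ = ENNReal.ofReal (β i.1 i.2 z) := fun i => by
      rw [← ofReal_norm, RCLike.norm_ofReal, abs_of_nonneg (hβ.nonneg _ _ _)]
    simp_rw [h4]
    rw [← ENNReal.ofReal_tsum_of_nonneg (fun i => hβ.nonneg _ _ _) (hβ.hasSum_one z).summable,
      (hβ.hasSum_one z).tsum_eq, ENNReal.ofReal_one]
  calc _ ≤ ∑' i : J × J, ‖(g z - g (x i.1, y i.2)) * (β i.1 i.2 z : 𝕜)‖ₑ := by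
        rw [h2]
        exact enorm_tsum_le_tsum_enorm
    _ ≤ ∑' i : J × J, G * ‖(β i.1 i.2 z : 𝕜)‖ₑ := by
        refine ENNReal.tsum_le_tsum fun i => ?_
        rw [enorm_mul]
        by_cases h0 : β i.1 i.2 z = 0
        · simp [h0]
        · gcongr
          exact hG _ (norm_sub_lt_of_mem_euclBall (hβ.support_subset _ _ h0))
    _ = G := by rw [ENNReal.tsum_mul_left, h3, mul_one]

theorem IsBUPU.aestronglyMeasurable_quasiInterp [Countable J] (hβ : IsBUPU r x y β)
    {g : Plane d → 𝕜} {B : ℝ} (hg : ∀ z, ‖g z‖ ≤ B) :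
    AEStronglyMeasurable (quasiInterp x y β g) := by
  refine aestronglyMeasurable_of_tendsto_ae atTop
    (f := fun (s : Finset (J × J)) z => ∑ i ∈ s, g (x i.1, y i.2) * (β i.1 i.2 z : 𝕜))
    (fun s => Finset.aestronglyMeasurable_fun_sum _ fun i _ => ?_)
    (.of_forall fun z => (hβ.summable_mul hg z).hasSum)
  exact (RCLike.continuous_ofReal.comp_aestronglyMeasurable
    (hβ.aemeasurable i.1 i.2).aestronglyMeasurable).const_mul _

end QuasiInterpolation

/-! ### Approximation on the shift-invariant space and the error recursion -/

section Reconstruction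

variable {𝕜 : Type*} [RCLike 𝕜] {d : ℕ} {p q : ℝ} {φ : Plane d → 𝕜}
  {P : (Plane d → 𝕜) → (Plane d → 𝕜)}

theorem exists_norm_le_of_mem_shiftInvariant (hp : 1 ≤ p) (hq : 1 ≤ q) (hφ : Continuous φ)
    (hφc : HasCompactSupport φ) {g : Plane d → 𝕜} (hg : g ∈ shiftInvariant p q φ) :
    ∃ B : ℝ, ∀ z, ‖g z‖ ≤ B := by
  obtain ⟨A, hA⟩ := exists_semiConv_bound hp hq hφ hφc
  obtain ⟨c, hc, rfl⟩ := hg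
  refine ⟨(A * seqNorm p q c).toReal, fun z => ?_⟩
  simpa using ENNReal.toReal_mono (by finiteness) ((hA c).2 z)

/-- The sup norm is dominated by the `L^{p,q}` norm on a complemented shift-invariant space. -/
theorem IsBoundedProjection.exists_enorm_le (hp : 1 ≤ p) (hq : 1 ≤ q) (hφ : Continuous φ)
    (hφc : HasCompactSupport φ) (hP : IsBoundedProjection p q φ P) :
    ∃ C : ℝ≥0, ∀ g ∈ shiftInvariant p q φ, ∀ z, ‖g z‖ₑ ≤ C * mixedNorm p q g := by
  obtain ⟨A, hA⟩ := exists_semiConv_bound hp hq hφ hφc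
  obtain ⟨C, hC⟩ := hP.exists_coeff_le hp hq hφ hφc
  refine ⟨A * C, fun g hg z => ?_⟩
  obtain ⟨c, hc, hle⟩ := hC g hg
  calc ‖g z‖ₑ ≤ A * seqNorm p q c := by
        rw [hc]
        exact (hA c).2 z
    _ ≤ A * (C * mixedNorm p q g) := by gcongr
    _ = _ := by rw [ENNReal.coe_mul, mul_assoc]

/-- Quasi-interpolation on a sufficiently fine set is close to the identity. -/
theorem IsBoundedProjection.exists_radius (hp : 1 ≤ p) (hq : 1 ≤ q) (hφ : Continuous φ)
    (hφc : HasCompactSupport φ) (hP : IsBoundedProjection p q φ P) {η : ℝ≥0} (hη : 0 < η) :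
    ∃ r : ℝ, 0 < r ∧ ∀ (J : Type*) (x : J → ℝ) (y : J → Fin d → ℝ) (β : J → J → Plane d → ℝ),
      IsBUPU r x y β → ∀ g ∈ shiftInvariant p q φ,
        mixedNorm p q (g - quasiInterp x y β g) ≤ η * mixedNorm p q g := by
  obtain ⟨C, hC⟩ := hP.exists_coeff_le hp hq hφ hφc
  obtain ⟨K, hK⟩ := exists_osc_semiConv_le hφ hφc
  set L : ℝ≥0 := K.card * C with hL
  -- Oscillation `ε` costs `ε * K.card * C = ε * L` in norm; `L + 1` allows for `L = 0`.
  obtain ⟨r, hr, hosc⟩ := hK (η / (L + 1)) (by positivity)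
  refine ⟨r, hr, fun J x y β hβ g hg => ?_⟩
  obtain ⟨B, hB⟩ := exists_norm_le_of_mem_shiftInvariant hp hq hφ hφc hg
  obtain ⟨c, hc, hle⟩ := hC g hg
  calc mixedNorm p q (g - quasiInterp x y β g)
      ≤ mixedLp p q fun z => (η / (L + 1) : ℝ≥0) * ∑ j ∈ K, ‖c (z.floor - j)‖ₑ := by
        rw [mixedNorm_eq_mixedLp]
        refine mixedLp_mono (zero_lt_one.trans_le hp) (zero_lt_one.trans_le hq) fun z => ?_
        refine hβ.enorm_sub_quasiInterp_le hB fun w hw => ?_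
        rw [hc]
        exact hosc c z w hw
    _ ≤ (η / (L + 1) * K.card : ℝ≥0) * (C * mixedNorm p q g) :=
        (mixedLp_sum_floor_le hp hq _ K c).trans (by gcongr)
    _ = (η / (L + 1) * L : ℝ≥0) * mixedNorm p q g := by
        rw [← mul_assoc, ← ENNReal.coe_mul, hL]
        ring_nf
    _ ≤ η * mixedNorm p q g := by
        gcongr
        rw [div_mul_eq_mul_div]
        exact div_le_of_le_mul₀ zero_le zero_le (by gcongr; exact le_self_add)

/-- The placeholder value 0 at index 0 makes the error recursion start at `n = 0`, with initial
error `f`. -/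
theorem sub_iterate_succ (P Q : (Plane d → 𝕜) → (Plane d → 𝕜)) (f : Plane d → 𝕜) (n : ℕ) :
    f - iterate P Q f (n + 1)
      = (f - iterate P Q f n) - P (Q (f - iterate P Q f n)) := by
  cases n with
  | zero => simp [iterate]
  | succ n =>
    rw [iterate]
    abel

end Reconstruction

end MixedSampling

end

/-! ### The main theorem -/

theorem theorem3p1 {𝕜 : Type*} [RCLike 𝕜] {d : ℕ} (p q : ℝ) (hp : 1 ≤ p) (hq : 1 ≤ q)
    (φ : MixedSampling.Plane d → 𝕜) (hφ : MixedSampling.MemWiener₀ 1 1 φ)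
    (hφc : HasCompactSupport φ)
    (P : (MixedSampling.Plane d → 𝕜) → (MixedSampling.Plane d → 𝕜))
    (hP : MixedSampling.IsBoundedProjection p q φ P) :
    ∃ γ : ℝ, 0 < γ ∧ ∃ r : ℝ, γ < r ∧ ∃ α : ℝ≥0, α < 1 ∧
      ∀ f ∈ MixedSampling.shiftInvariant p q φ, ∃ M : ℝ≥0,
        ∀ (J : Type*) [Countable J] (x : J → ℝ) (y : J → Fin d → ℝ)
          (β : J → J → MixedSampling.Plane d → ℝ),
          MixedSampling.IsDenseSampling γ x y → MixedSampling.IsBUPU r x y β →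
          -- the quasi-interpolant is well defined on `V_{p,q}(φ)`, with values in `L^{p,q}`
          (∀ g ∈ MixedSampling.shiftInvariant p q φ,
            (∀ z, Summable fun i : J × J => g (x i.1, y i.2) * (β i.1 i.2 z : 𝕜)) ∧
            MixedSampling.MemMixedLp p q (MixedSampling.quasiInterp x y β g)) ∧
          -- the iterates lie in `V_{p,q}(φ)`
          (∀ n : ℕ, 1 ≤ n →
            MixedSampling.iterate P (MixedSampling.quasiInterp x y β) f n
              ∈ MixedSampling.shiftInvariant p q φ) ∧
          -- convergence in `L^{p,q}`
          Tendsto (fun n => MixedSampling.mixedNorm p q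
            (f - MixedSampling.iterate P (MixedSampling.quasiInterp x y β) f n)) atTop (𝓝 0) ∧
          -- uniform convergence
          TendstoUniformly
            (fun n => MixedSampling.iterate P (MixedSampling.quasiInterp x y β) f n) f atTop ∧
          -- geometric rate
          (∀ n : ℕ, 1 ≤ n → MixedSampling.MemMixedLp p q
              (f - MixedSampling.iterate P (MixedSampling.quasiInterp x y β) f n) ∧
            MixedSampling.mixedNorm p q
              (f - MixedSampling.iterate P (MixedSampling.quasiInterp x y β) f n)
                ≤ ((M * α ^ n : ℝ≥0) : ℝ≥0∞)) := by
  open MixedSampling in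
  have hp0 : 0 < p := zero_lt_one.trans_le hp
  have hq0 : 0 < q := zero_lt_one.trans_le hq
  have hmem := fun {g : Plane d → 𝕜} (hg : g ∈ shiftInvariant p q φ) =>
    memMixedLp_of_mem_shiftInvariant hp hq hφ.1 hφc hg
  obtain ⟨V, hV⟩ := exists_submodule_coe_eq_shiftInvariant hp hq hφc
  obtain ⟨B, hB⟩ := hP.bounded
  obtain ⟨C, hC⟩ := hP.exists_enorm_le hp hq hφ.1 hφc
  -- Chosen so that `B * η ≤ 1/2`, where `B` bounds `P`.
  obtain ⟨r, hr, hQ⟩ := hP.exists_radius hp hq hφ.1 hφc (η := 2⁻¹ / (B + 1)) (by positivity)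
  refine ⟨r / 2, by positivity, r, by linarith, 2⁻¹, by norm_num, fun f hf => ?_⟩
  refine ⟨(mixedNorm p q f).toNNReal, fun J _ x y β _ hβ => ?_⟩
  replace hQ := hQ J x y β hβ
  have hQmem : ∀ g ∈ shiftInvariant p q φ, MemMixedLp p q (quasiInterp x y β g) := fun g hg => by
    obtain ⟨b, hb⟩ := exists_norm_le_of_mem_shiftInvariant hp hq hφ.1 hφc hg
    have hm := hβ.aestronglyMeasurable_quasiInterp hb
    have h1 : MemMixedLp p q (g - quasiInterp x y β g) :=
      ⟨(hmem hg).1.sub hm, (hQ g hg).trans_lt (ENNReal.mul_lt_top ENNReal.coe_lt_top (hmem hg).2)⟩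
    simpa using (hmem hg).sub hp hq h1
  have hcontr : ∀ g ∈ shiftInvariant p q φ,
      mixedNorm p q (g - P (quasiInterp x y β g)) ≤ (2⁻¹ : ℝ≥0) * mixedNorm p q g := fun g hg => by
    have h1 : g - P (quasiInterp x y β g) = P (g - quasiInterp x y β g) := by
      rw [hP.map_sub hp hq (hmem hg) (hQmem g hg), hP.fixes g hg]
    calc _ ≤ B * mixedNorm p q (g - quasiInterp x y β g) := by
          rw [h1]
          exact hB _ ((hmem hg).sub hp hq (hQmem g hg))
      _ ≤ B * ((2⁻¹ / (B + 1) : ℝ≥0) * mixedNorm p q g) := by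
          gcongr
          exact hQ g hg
      _ = (B * (2⁻¹ / (B + 1)) : ℝ≥0) * mixedNorm p q g := by rw [ENNReal.coe_mul, mul_assoc]
      _ ≤ _ := by
          gcongr
          rw [mul_div_assoc', mul_comm]
          exact div_le_of_le_mul₀ zero_le zero_le (by gcongr; exact le_self_add)
  set Q := quasiInterp (𝕜 := 𝕜) x y β with hQdef
  -- Membership is carried along because the contraction holds only on the shift-invariant space.
  -- The initial error `f` gives `M = ‖f‖`.
  have herr : ∀ n, f - iterate P Q f n ∈ shiftInvariant p q φ ∧
      mixedNorm p q (f - iterate P Q f n)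
        ≤ (((mixedNorm p q f).toNNReal * 2⁻¹ ^ n : ℝ≥0) : ℝ≥0∞) := fun n => by
    induction n with
    | zero => simp [iterate, hf, ENNReal.coe_toNNReal (hmem hf).2.ne]
    | succ n ih =>
      rw [sub_iterate_succ]
      refine ⟨(hV _).1 (V.sub_mem ((hV _).2 ih.1) ((hV _).2 (hP.mem _ (hQmem _ ih.1)))), ?_⟩
      calc _ ≤ (2⁻¹ : ℝ≥0) * (((mixedNorm p q f).toNNReal * 2⁻¹ ^ n : ℝ≥0) : ℝ≥0∞) :=
            (hcontr _ ih.1).trans (by gcongr; exact ih.2)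
        _ = _ := by
          rw [← ENNReal.coe_mul]
          ring_nf
  have hlim : Tendsto (fun n => mixedNorm p q (f - iterate P Q f n)) atTop (𝓝 0) := by
    refine tendsto_of_tendsto_of_tendsto_of_le_of_le tendsto_const_nhds ?_ (fun _ => zero_le)
      fun n => (herr n).2
    have h1 : Tendsto (fun n => (mixedNorm p q f).toNNReal * 2⁻¹ ^ n) atTop (𝓝 0) := by
      simpa using (NNReal.tendsto_pow_atTop_nhds_zero_of_lt_one
        (show (2⁻¹ : ℝ≥0) < 1 by norm_num)).const_mul (mixedNorm p q f).toNNReal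
    exact ENNReal.tendsto_coe.2 h1
  refine ⟨fun g hg => ⟨?_, hQmem g hg⟩, fun n _ => ?_, hlim, ?_,
    fun n _ => ⟨hmem (herr n).1, (herr n).2⟩⟩
  · obtain ⟨b, hb⟩ := exists_norm_le_of_mem_shiftInvariant hp hq hφ.1 hφc hg
    exact hβ.summable_mul hb
  -- Each iterate is `f` minus its error, both in `V`.
  · have := V.sub_mem ((hV _).2 hf) ((hV _).2 (herr n).1)
    rw [sub_sub_cancel] at this
    exact (hV _).1 this
  · rw [EMetric.tendstoUniformly_iff]
    intro ε hε
    have h1 : Tendsto (fun n => C * mixedNorm p q (f - iterate P Q f n)) atTop (𝓝 0) := by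
      simpa using ENNReal.Tendsto.const_mul hlim (.inr ENNReal.coe_ne_top)
    filter_upwards [h1.eventually_lt_const hε] with n hn z
    rw [edist_eq_enorm_sub]
    exact (hC _ (herr n).1 z).trans_lt hn
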